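/- **Labelled transition systems.** A labelled transition system (LTS) is a tuple $s=\langle Q_s,I_s,U_s,T_s,q_0\rangle$ with a countable set $Q_s$ of states, an initial state $q_0\in Q_s$, countable disjoint sets $I_s$ (inputs) and $U_s$ (outputs), and $T_s\subseteq Q_s\times(I_s\cup U_s\cup\{\tau\})\times Q_s$. Put $L_s=I_s\cup U_s$. All LTSs are assumed strongly converging (no infinite sequence of $\tau$-steps) and image-finite (for all $q$ and $\sigma\in L_s^*$ only finitely many $q'$ satisfy $q\overset{\sigma}{\Rightarrow}q'$). Write $q\xrightarrow{x}q'$ for $(q,x,q')\in T_s$, and $q\xrightarrow{\delta}q'$ (quiescence, $\delta\notin L_s$) iff $q=q'$ and $q$ has no outgoing transition labelled by an output or by $\tau$. For a word $\sigma$ over $L_s^\delta=L_s\cup\{\delta\}$, $q\overset{\sigma}{\Rightarrow}q'$ means that $q'$ is reached from $q$ by the steps of $\sigma$, with arbitrary finite numbers of $\tau$-steps before, between and after them. For $X\subseteq Q_s$ let $X\text{ after }\sigma=\{q'\mid\exists q\in X:\ q\overset{\sigma}{\Rightarrow}q'\}$, $\mathrm{out}(X)=\{x\in U_s\cup\{\delta\}\mid\exists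 q\in X:\ q\xrightarrow{x}\}$ and $\mathrm{in}(X)=\{\ell\in I_s\mid\forall q\in X:\ q\overset{\ell}{\Rightarrow}\}$; $s\text{ after }\epsilon$ means $\{q_0\}\text{ after }\epsilon$. The LTS $i$ is input-enabled if $q\overset{\ell}{\Rightarrow}$ for all $q\in Q_i$, $\ell\in I_i$. LTSs $s,e$ are composable if $U_s\cap U_e=\emptyset$. **Environmental conformance.** $s\ \mathbf{eco}\ e$ holds iff there is $R\subseteq\mathcal P(Q_s)\times\mathcal P(Q_e)$ with $(s\text{ after }\epsilon,e\text{ after }\epsilon)\in R$ and, for all $(X_s,X_e)\in R$: (a) for $\ell\in\mathrm{out}(X_e)\cap I_s$: $\ell\in\mathrm{in}(X_s)$ and $(X_s\text{ after }\ell,X_e\text{ after }\ell)\in R$; (b) for $\ell\in\mathrm{out}(X_s)\cap I_e$: $\ell\in\mathrm{in}(X_e)$ and $(X_s\text{ after }\ell,X_e\text{ after }\ell)\in R$; (c) for $\ell\in(\mathrm{out}(X_e)\cup\mathrm{in}(X_e))\setminus L_s^\delta$: $(X_s,X_e\text{ after }\ell)\in R$; (d) for $\ell\in(\mathrm{out}(X_s)\cup\mathrm{in}(X_s))\setminus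 L_e^\delta$: $(X_s\text{ after }\ell,X_e)\in R$; (e) for $\ell\in\mathrm{in}(X_s)\cap\mathrm{in}(X_e)$: $(X_s\text{ after }\ell,X_e\text{ after }\ell)\in R$; (f) if $\delta\in\mathrm{out}(X_s)\cap\mathrm{out}(X_e)$: $(X_s\text{ after }\delta,X_e\text{ after }\delta)\in R$. **Test cases.** Let $\theta$ be a special label, not a label of any system under test or environment. A test case $t$ is an LTS without $\tau$-transitions, with $\theta\in I_t$ and two distinct terminal states $\mathbf{pass}$, $\mathbf{fail}$ whose only transitions are self-loops, one for every $\ell\in I_t$, such that: every non-terminal state other than the initial one has exactly one incoming transition; there is no infinite path through non-terminal states; every state has at most one outgoing transition labelled in $U_t$; and every state has exactly one outgoing $\ell$-transition for each $\ell\in I_t\setminus\{\theta\}$. **Test execution.** For a test case $t$ and an input-enabled $i$, the test execution of $t$ on $i$ has state set $Q_t\times Q_i$, initial state the pair of initial states, and exactly the following transitions: $(p,q)\xrightarrow{\tau}(p,q')$ if $q\xrightarrow{\tau}q'$; $(p,q)\xrightarrow{\ell}(p,q')$ if $q\xrightarrow{\ell}q'$ and $\ell\in L_i\setminus L_t$;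 $(p,q)\xrightarrow{\ell}(p',q)$ if $p\xrightarrow{\ell}p'$ and $\ell\in L_t\setminus(L_i\cup\{\theta\})$; $(p,q)\xrightarrow{\ell}(p',q')$ if $p\xrightarrow{\ell}p'$, $q\xrightarrow{\ell}q'$ and $\ell\in L_i\cap L_t$; $(p,q)\xrightarrow{\theta}(p',q')$ if $p\xrightarrow{\theta}p'$ and $q\xrightarrow{\delta}q'$. A test run is a trace $\sigma$ (a word over $L_i\cup L_t$, so $\theta$ may occur) that leads from the initial state to a state $(\mathbf{pass},q)$ or $(\mathbf{fail},q)$. Then $i$ passes $t$ iff no test run reaches a state $(\mathbf{fail},q)$, and $i$ passes a set of test cases iff it passes each of its members. **Test generation.** Let $e$ be an LTS and $I_i,U_i$ disjoint countable sets of labels. Behaviour expressions are built from $\mathbf{pass}$, $\mathbf{fail}$, prefixing $\ell;B$ and choice $\sum\mathcal B$ over a possibly empty family, with $\ell;B\xrightarrow{\ell}B$, and $\sum\mathcal B\xrightarrow{\ell}B'$ whenever $B\xrightarrow{\ell}B'$ for some $B\in\mathcal B$; $B_1\,\square\,B_2$ is binary choice. For $X\subseteq Q_e$, the non-deterministic recursive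 procedure $\mathrm{GenEcoTest}(X)$ returns an expression by one of the following cases (the recursion is well-founded; recursive calls choose independently): (A) $\mathbf{pass}$; (B) for some $\ell\in(\mathrm{out}(X)\cup\mathrm{in}(X))\cap I_i$: $\ \ell;\mathrm{GenEcoTest}(X\text{ after }\ell)\ \square\ \mathrm{GenInputResponse}(X)$; (C) if $\delta\in\mathrm{out}(X)$: $\ \theta;\mathrm{GenEcoTest}(X\text{ after }\delta)\ \square\ \mathrm{GenInputResponse}(X)$; (D) for some $\ell\in(\mathrm{out}(X)\cup\mathrm{in}(X))\setminus(I_i\cup U_i\cup\{\delta\})$: $\ \ell;\mathrm{GenEcoTest}(X\text{ after }\ell)\ \square\ \mathrm{GenInputResponse}(X)$; (E) for some $\ell\in I_i\setminus L_e$: $\ \ell;\mathrm{GenEcoTest}(X)\ \square\ \mathrm{GenInputResponse}(X)$. Here $\mathrm{GenInputResponse}(X)$ returns $$\sum\{\ell;\mathbf{fail}\mid\ell\in(U_i\cap I_e)\setminus\mathrm{in}(X)\}\ \square\ \sum\{\ell;\mathrm{GenEcoTest}(X\text{ after }\ell)\mid\ell\in U_i\cap\mathrm{in}(X)\},$$ with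 one recursive call for each $\ell$. An outcome of $\mathrm{GenEcoTest}(e\text{ after }\epsilon)$ is turned into a transition system with inputs $(U_i\cap I_e)\cup\{\theta\}$ and outputs $U_e\cup(I_e\setminus U_i)\cup(I_i\setminus L_e)$: its states are $\mathbf{pass}$, $\mathbf{fail}$ (with self-loops for every input) and the reachable occurrences of the other expressions, equal expressions at different places of the tree being different states; its initial state is the outcome itself. Let $\mathcal{TTS}[L_i,e]$ be the set of all transition systems generated in this way. **Theorem.** Let $e$ be an LTS and let $I_i$, $U_i$ be disjoint countable sets of labels. Every member of $\mathcal{TTS}[L_i,e]$ is a test case, and the test suite $\mathcal{TTS}[L_i,e]$ is complete (sound and exhaustive): for every input-enabled LTS $i$ with inputs $I_i$ and outputs $U_i$ that is composable with $e$, $$ i\ \mathbf{eco}\ e\iff i\text{ passes every test case in }\mathcal{TTS}[L_i,e]. $$ -/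

import Mathlib

universe u v w

namespace EcoTesting

/-! ### Labelled transition systems -/

/-- The data of a labelled transition system `⟨Q, I, U, T, q₀⟩` over a universe `Act` of labels.
In `T`, the label `none` is the internal action `τ` and `some ℓ` is the visible label `ℓ`. -/
structure LTS (Act : Type u) where
  Q : Type v
  I : Set Act
  U : Set Act
  T : Q → Option Act → Q → Prop
  q₀ : Q

/-- The elements of `L^δ`: visible labels and quiescence `δ`. -/
inductive ObsLabel (Act : Type u) : Type u where
  | act (a : Act) : ObsLabel Act
  | delta : ObsLabel Act

namespace LTS

variable {Act : Type u}

/-- `L = I ∪ U`. -/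
def L (s : LTS.{u, v} Act) : Set Act := s.I ∪ s.U

/-- `q` enables no output and no internal action. -/
def Quiescent (s : LTS.{u, v} Act) (q : s.Q) : Prop :=
  (∀ x ∈ s.U, ∀ q', ¬ s.T q (some x) q') ∧ ∀ q', ¬ s.T q none q'

/-- The transitions `q --x--> q'` for `x ∈ L^δ`. -/
def ObsStep (s : LTS.{u, v} Act) (q : s.Q) : ObsLabel Act → s.Q → Prop
  | .act a, q' => s.T q (some a) q'
  | .delta, q' => q = q' ∧ s.Quiescent q

/-- `q ==ε==> q'`: finitely many internal steps. -/
def Silent (s : LTS.{u, v} Act) : s.Q → s.Q → Prop :=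
  Relation.ReflTransGen fun q q' => s.T q none q'

/-- `q ==σ==> q'` for a sequence `σ` over `L^δ`. -/
def ObsWeak (s : LTS.{u, v} Act) : s.Q → List (ObsLabel Act) → s.Q → Prop
  | q, [], q' => s.Silent q q'
  | q, x :: σ, q' => ∃ q₁ q₂, s.Silent q q₁ ∧ s.ObsStep q₁ x q₂ ∧ s.ObsWeak q₂ σ q'

/-- `q ==σ==> q'` for a sequence `σ` over `L`. -/
def Weak (s : LTS.{u, v} Act) (q : s.Q) (σ : List Act) (q' : s.Q) : Prop :=
  s.ObsWeak q (σ.map ObsLabel.act) q'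

/-- The laws of a labelled transition system, including the standing restriction to strongly
converging (no infinite sequence of internal actions) and image-finite systems. -/
structure IsLTS (s : LTS.{u, v} Act) : Prop where
  countable_Q : Countable s.Q
  countable_I : s.I.Countable
  countable_U : s.U.Countable
  disjoint : Disjoint s.I s.U
  label_mem : ∀ q ℓ q', s.T q (some ℓ) q' → ℓ ∈ s.L
  strongly_converging : ¬ ∃ f : ℕ → s.Q, ∀ n, s.T (f n) none (f (n + 1))
  image_finite : ∀ (q : s.Q) (σ : List Act), {q' | s.Weak q σ q'}.Finite

/-- Input-enabled transition systems. -/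
def IsInputEnabled (s : LTS.{u, v} Act) : Prop :=
  s.IsLTS ∧ ∀ (q : s.Q), ∀ ℓ ∈ s.I, ∃ q', s.Weak q [ℓ] q'

/-- `X after σ`. -/
def after (s : LTS.{u, v} Act) (X : Set s.Q) (σ : List (ObsLabel Act)) : Set s.Q :=
  {q' | ∃ q ∈ X, s.ObsWeak q σ q'}

/-- `s after ε`. -/
def init (s : LTS.{u, v} Act) : Set s.Q := s.after {s.q₀} []

/-- `U^δ`. -/
def Udelta (s : LTS.{u, v} Act) : Set (ObsLabel Act) :=
  {x | x = .delta ∨ ∃ a ∈ s.U, x = .act a}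

/-- `out(X)`: the outputs, including `δ`, enabled in some state of `X`. -/
def out (s : LTS.{u, v} Act) (X : Set s.Q) : Set (ObsLabel Act) :=
  {x | x ∈ s.Udelta ∧ ∃ q ∈ X, ∃ q', s.ObsStep q x q'}

/-- `in(X)`: the inputs that are weakly enabled in every state of `X`. -/
def inp (s : LTS.{u, v} Act) (X : Set s.Q) : Set Act :=
  {ℓ | ℓ ∈ s.I ∧ ∀ q ∈ X, ∃ q', s.Weak q [ℓ] q'}

/-- Composable systems share no outputs. -/
def Composable (s : LTS.{u, v} Act) (e : LTS.{u, w} Act) : Prop := Disjoint s.U e.U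

/-! ### Environmental conformance -/

/-- Environmental conformance simulations. -/
structure IsEcoSim (s : LTS.{u, v} Act) (e : LTS.{u, w} Act)
    (R : Set (Set s.Q × Set e.Q)) : Prop where
  base : (s.init, e.init) ∈ R
  sync_out_env : ∀ Xs Xe, (Xs, Xe) ∈ R → ∀ ℓ : Act, .act ℓ ∈ e.out Xe → ℓ ∈ s.I →
    ℓ ∈ s.inp Xs ∧ (s.after Xs [.act ℓ], e.after Xe [.act ℓ]) ∈ R
  sync_out_sys : ∀ Xs Xe, (Xs, Xe) ∈ R → ∀ ℓ : Act, .act ℓ ∈ s.out Xs → ℓ ∈ e.I →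
    ℓ ∈ e.inp Xe ∧ (s.after Xs [.act ℓ], e.after Xe [.act ℓ]) ∈ R
  internal_env : ∀ Xs Xe, (Xs, Xe) ∈ R → ∀ ℓ : Act, (.act ℓ ∈ e.out Xe ∨ ℓ ∈ e.inp Xe) →
    ℓ ∉ s.L → (Xs, e.after Xe [.act ℓ]) ∈ R
  internal_sys : ∀ Xs Xe, (Xs, Xe) ∈ R → ∀ ℓ : Act, (.act ℓ ∈ s.out Xs ∨ ℓ ∈ s.inp Xs) →
    ℓ ∉ e.L → (s.after Xs [.act ℓ], Xe) ∈ R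
  sync_in : ∀ Xs Xe, (Xs, Xe) ∈ R → ∀ ℓ : Act, ℓ ∈ s.inp Xs → ℓ ∈ e.inp Xe →
    (s.after Xs [.act ℓ], e.after Xe [.act ℓ]) ∈ R
  quiescence : ∀ Xs Xe, (Xs, Xe) ∈ R → .delta ∈ s.out Xs → .delta ∈ e.out Xe →
    (s.after Xs [.delta], e.after Xe [.delta]) ∈ R

/-- `s eco e`. -/
def Eco (s : LTS.{u, v} Act) (e : LTS.{u, w} Act) : Prop :=
  ∃ R : Set (Set s.Q × Set e.Q), IsEcoSim s e R

end LTS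

/-! ### Test cases and test execution -/

/-- Labels of test cases: ordinary labels and the special label `θ` (observing quiescence). -/
inductive TestLabel (Act : Type u) : Type u where
  | act (a : Act) : TestLabel Act
  | theta : TestLabel Act

/-- A transition system over test labels with two distinguished states. -/
structure TestLTS (Act : Type u) extends LTS.{u, v} (TestLabel Act) where
  passState : Q
  failState : Q

namespace TestLTS

variable {Act : Type u}

/-- The state `q` is `pass` or `fail`. -/
def IsTerminal (t : TestLTS.{u, v} Act) (q : t.Q) : Prop := q = t.passState ∨ q = t.failState

/-- Test cases. -/
structure IsTestCase (t : TestLTS.{u, v} Act) : Prop where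
  isLTS : t.toLTS.IsLTS
  /-- Every non-terminal state except the starting state has exactly one incoming transition. -/
  tree : ∀ q, ¬ t.IsTerminal q → q ≠ t.q₀ → ∃! p : t.Q × Option (TestLabel Act), t.T p.1 p.2 q
  /-- Finite behaviour: no infinite path through non-terminal states. -/
  finite_behaviour : ¬ ∃ f : ℕ → t.Q, ∀ n, ¬ t.IsTerminal (f n) ∧ ∃ x, t.T (f n) x (f (n + 1))
  pass_ne_fail : t.passState ≠ t.failState
  pass_loops : ∀ x q, t.T t.passState x q ↔ (∃ ℓ ∈ t.I, x = some ℓ) ∧ q = t.passState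
  fail_loops : ∀ x q, t.T t.failState x q ↔ (∃ ℓ ∈ t.I, x = some ℓ) ∧ q = t.failState
  theta_mem : .theta ∈ t.I
  one_output : ∀ q ℓ₁ ℓ₂ q₁ q₂, ℓ₁ ∈ t.U → ℓ₂ ∈ t.U →
    t.T q (some ℓ₁) q₁ → t.T q (some ℓ₂) q₂ → ℓ₁ = ℓ₂ ∧ q₁ = q₂
  receptive : ∀ q, ∀ ℓ ∈ t.I, ℓ ≠ .theta → ∃! q', t.T q (some ℓ) q'
  no_tau : ∀ q q', ¬ t.T q none q'

end TestLTS

/-- The transition relation of the test execution of `t` on `i`. -/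
inductive TestExecStep {Act : Type u} (t : TestLTS.{u, v} Act) (i : LTS.{u, w} Act) :
    t.Q × i.Q → Option (TestLabel Act) → t.Q × i.Q → Prop
  | tau {p : t.Q} {q q' : i.Q} : i.T q none q' → TestExecStep t i (p, q) none (p, q')
  | sut {p : t.Q} {q q' : i.Q} {a : Act} : i.T q (some a) q' → a ∈ i.L → .act a ∉ t.L →
      TestExecStep t i (p, q) (some (.act a)) (p, q')
  | test {p p' : t.Q} {q : i.Q} {a : Act} : t.T p (some (.act a)) p' → .act a ∈ t.L → a ∉ i.L →
      TestExecStep t i (p, q) (some (.act a)) (p', q)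
  | sync {p p' : t.Q} {q q' : i.Q} {a : Act} : t.T p (some (.act a)) p' → i.T q (some a) q' →
      a ∈ i.L → .act a ∈ t.L → TestExecStep t i (p, q) (some (.act a)) (p', q')
  | theta {p p' : t.Q} {q q' : i.Q} : t.T p (some .theta) p' → i.ObsStep q .delta q' →
      TestExecStep t i (p, q) (some .theta) (p', q')

/-- Test execution. All labels, including `θ`, are observable in a run. -/
def testExec {Act : Type u} (t : TestLTS.{u, v} Act) (i : LTS.{u, w} Act) :
    LTS (TestLabel Act) where
  Q := t.Q × i.Q
  I := ∅
  U := TestLabel.act '' i.U ∪ t.L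
  T := TestExecStep t i
  q₀ := (t.q₀, i.q₀)

/-- The test runs of `t` on `i`: the traces of the test execution that reach `pass` or `fail`. -/
def testRuns {Act : Type u} (t : TestLTS.{u, v} Act) (i : LTS.{u, w} Act) :
    Set (List (TestLabel Act)) :=
  {σ | ∃ q : i.Q, (testExec t i).Weak (testExec t i).q₀ σ (t.passState, q) ∨
    (testExec t i).Weak (testExec t i).q₀ σ (t.failState, q)}

/-- `i passes t`. -/
def Passes {Act : Type u} (i : LTS.{u, w} Act) (t : TestLTS.{u, v} Act) : Prop :=
  ∀ σ ∈ testRuns t i, ∀ q : i.Q, ¬ (testExec t i).Weak (testExec t i).q₀ σ (t.failState, q)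

/-- `i passes TS`. -/
def PassesSuite {Act : Type u} (i : LTS.{u, w} Act) (TS : Set (TestLTS.{u, v} Act)) : Prop :=
  ∀ t ∈ TS, Passes i t

/-! ### Behaviour expressions -/

/-- Behaviour expressions: action followed by behaviour, and choice over a (possibly empty) family;
`pass` and `fail` are the two recursively defined constants, see `BExp.Step`. -/
inductive BExp (Λ : Type u) : Type (u + 1) where
  | pass : BExp Λ
  | fail : BExp Λ
  | seq (ℓ : Λ) (B : BExp Λ) : BExp Λ
  | sum {ι : Type u} (F : ι → BExp Λ) : BExp Λ

namespace BExp

variable {Λ : Type u}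

/-- Binary choice `B₁ □ B₂`. -/
def choice (B₁ B₂ : BExp Λ) : BExp Λ :=
  sum fun b : ULift.{u} Bool => if b.down then B₁ else B₂

/-- The transitions of behaviour expressions, where `It` is the set of inputs of the test case:
`pass = ∑ {ℓ; pass | ℓ ∈ It}` and `fail = ∑ {ℓ; fail | ℓ ∈ It}`. -/
inductive Step (It : Set Λ) : BExp Λ → Λ → BExp Λ → Prop
  | seq (ℓ : Λ) (B : BExp Λ) : Step It (seq ℓ B) ℓ B
  | sum {ι : Type u} (F : ι → BExp Λ) (k : ι) {ℓ : Λ} {B' : BExp Λ} :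
      Step It (F k) ℓ B' → Step It (sum F) ℓ B'
  | pass {ℓ : Λ} : ℓ ∈ It → Step It pass ℓ pass
  | fail {ℓ : Λ} : ℓ ∈ It → Step It fail ℓ fail

/-- The occurrence of an expression after the history `σ` (most recent label first). The constants
`pass` and `fail` each stand for a single state; any other expression is tagged with its history,
so that equal expressions at different places of a test case are different states of the tree. -/
def occ (σ : List Λ) : BExp Λ → List Λ × BExp Λ
  | pass => ([], pass)
  | fail => ([], fail)
  | seq ℓ B => (σ, seq ℓ B)
  | sum F => (σ, sum F)

/-- The states of the transition system represented by `B`: `pass`, `fail`, and all occurrences of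
expressions reachable from `B`. -/
inductive IsState (It : Set Λ) (B : BExp Λ) : List Λ × BExp Λ → Prop
  | root : IsState It B (occ [] B)
  | pass : IsState It B ([], pass)
  | fail : IsState It B ([], fail)
  | step {σ : List Λ} {C C' : BExp Λ} {ℓ : Λ} :
      IsState It B (σ, C) → Step It C ℓ C' → IsState It B (occ (ℓ :: σ) C')

/-- The transition system with inputs `It` and outputs `Ut` represented by `B`. -/
def toTestLTS {Act : Type u} (It Ut : Set (TestLabel Act)) (B : BExp (TestLabel Act)) :
    TestLTS.{u, u + 1} Act where
  Q := {p // IsState It B p}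
  I := It
  U := Ut
  T p x p' := ∃ ℓ C', x = some ℓ ∧ Step It p.1.2 ℓ C' ∧ p'.1 = occ (ℓ :: p.1.1) C'
  q₀ := ⟨occ [] B, .root⟩
  passState := ⟨([], pass), .pass⟩
  failState := ⟨([], fail), .fail⟩

end BExp

/-! ### Test generation -/

section Generation

variable {Act : Type u}

/-- The expression returned by `GenInputResponse` on `X`, where `F ℓ` is the outcome of the
recursive call of `GenEcoTest` on `X after ℓ`. -/
def inputResponse (e : LTS.{u, v} Act) (Ui : Set Act) (X : Set e.Q)
    (F : {ℓ : Act // ℓ ∈ Ui ∩ e.inp X} → BExp (TestLabel Act)) : BExp (TestLabel Act) :=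
  .choice
    (.sum fun ℓ : {ℓ : Act // ℓ ∈ (Ui ∩ e.I) \ e.inp X} => .seq (.act ℓ.1) .fail)
    (.sum fun ℓ : {ℓ : Act // ℓ ∈ Ui ∩ e.inp X} => .seq (.act ℓ.1) (F ℓ))

/-- `GenEcoTest e Ii Ui X B`: the non-deterministic procedure `GenEcoTest`, called on the set `X`
of states of `e`, for a system under test with inputs `Ii` and outputs `Ui`, can return `B`. -/
inductive GenEcoTest (e : LTS.{u, v} Act) (Ii Ui : Set Act) :
    Set e.Q → BExp (TestLabel Act) → Prop
  /-- (A) Stop testing. -/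
  | passed (X : Set e.Q) : GenEcoTest e Ii Ui X .pass
  /-- (B) Perform an input on the system under test. -/
  | input (X : Set e.Q) (ℓ : Act) (B : BExp (TestLabel Act))
      (F : {k : Act // k ∈ Ui ∩ e.inp X} → BExp (TestLabel Act)) :
      (.act ℓ ∈ e.out X ∨ ℓ ∈ e.inp X) → ℓ ∈ Ii →
      GenEcoTest e Ii Ui (e.after X [.act ℓ]) B →
      (∀ k, GenEcoTest e Ii Ui (e.after X [.act k.1]) (F k)) →
      GenEcoTest e Ii Ui X (.choice (.seq (.act ℓ) B) (inputResponse e Ui X F))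
  /-- (C) Observe quiescence. -/
  | observe (X : Set e.Q) (B : BExp (TestLabel Act))
      (F : {k : Act // k ∈ Ui ∩ e.inp X} → BExp (TestLabel Act)) :
      .delta ∈ e.out X →
      GenEcoTest e Ii Ui (e.after X [.delta]) B →
      (∀ k, GenEcoTest e Ii Ui (e.after X [.act k.1]) (F k)) →
      GenEcoTest e Ii Ui X (.choice (.seq .theta B) (inputResponse e Ui X F))
  /-- (D) Simulate non-interacting behaviour of the environment. -/
  | environment (X : Set e.Q) (ℓ : Act) (B : BExp (TestLabel Act))
      (F : {k : Act // k ∈ Ui ∩ e.inp X} → BExp (TestLabel Act)) :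
      (.act ℓ ∈ e.out X ∨ ℓ ∈ e.inp X) → ℓ ∉ Ii ∪ Ui →
      GenEcoTest e Ii Ui (e.after X [.act ℓ]) B →
      (∀ k, GenEcoTest e Ii Ui (e.after X [.act k.1]) (F k)) →
      GenEcoTest e Ii Ui X (.choice (.seq (.act ℓ) B) (inputResponse e Ui X F))
  /-- (E) Generate non-interacting behaviour of the system under test. -/
  | system (X : Set e.Q) (ℓ : Act) (B : BExp (TestLabel Act))
      (F : {k : Act // k ∈ Ui ∩ e.inp X} → BExp (TestLabel Act)) :
      ℓ ∈ Ii → ℓ ∉ e.L →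
      GenEcoTest e Ii Ui X B →
      (∀ k, GenEcoTest e Ii Ui (e.after X [.act k.1]) (F k)) →
      GenEcoTest e Ii Ui X (.choice (.seq (.act ℓ) B) (inputResponse e Ui X F))

/-- Inputs of the generated test cases: `(Ui ∩ Ie) ∪ {θ}`. -/
def testInputs (e : LTS.{u, v} Act) (Ui : Set Act) : Set (TestLabel Act) :=
  TestLabel.act '' (Ui ∩ e.I) ∪ {.theta}

/-- Outputs of the generated test cases: `Ue ∪ (Ie \ Ui) ∪ (Ii \ Le)`. -/
def testOutputs (e : LTS.{u, v} Act) (Ii Ui : Set Act) : Set (TestLabel Act) :=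
  TestLabel.act '' (e.U ∪ (e.I \ Ui) ∪ (Ii \ e.L))

/-- The test suite of all test cases generated from `e` for a system under test with inputs `Ii`
and outputs `Ui`. -/
def ecoTestSuite (e : LTS.{u, v} Act) (Ii Ui : Set Act) : Set (TestLTS.{u, u + 1} Act) :=
  {t | ∃ B, GenEcoTest e Ii Ui e.init B ∧
    t = B.toTestLTS (testInputs e Ui) (testOutputs e Ii Ui)}

end Generation

end EcoTesting

/-!
The key is to read a test execution on pairs `(C, q)` of a behaviour expression and a state of the
system under test (`ExprStep`); by `passes_toTestLTS_iff`, passing a generated test case means that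
no pair `(fail, q)` is reachable there from the initial pair. Apart from `pass`, an outcome of
`GenEcoTest` on `X` consists of one *opening* action (`Opening`, the four cases (B) to (E)) and the
responses to the outputs of the system; `genEcoTest_iff` and `step_choice_inputResponse_iff`
describe outcomes and their transitions in these terms.

*Test cases.* The opening action is never an output of the system, so the transitions of an outcome
are deterministic (`IsOutcome.step_unique`). Hence a history determines the non-terminal state it
leads to (`BExp.IsState.eq_of_history_eq`), which makes the test case a countable tree. Transitions
descend structurally in the expression, so the tree has no infinite path.

*Soundness.* If `R` is a conformance simulation, then every pair `(C, q)` reachable in the test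
execution has `C = pass`, or else `C` is an outcome for some `Xe` and `q` lies in some `Xs` with
`(Xs, Xe) ∈ R`. Each rule of `ExprStep` corresponds to one of the clauses of `IsEcoSim`, and the
clause for outputs of the system excludes the step to `fail`.

*Exhaustiveness.* The pairs `(Xs, Xe)` such that no outcome for `Xe` can fail from a state of `Xs`,
with `Xe` nonempty and closed under internal steps, form a conformance simulation: a failing outcome
for a successor pair is extended to a failing outcome for `(Xs, Xe)`. For the clause about outputs
of the system an outcome different from `pass` is needed: strong convergence yields
an output or quiescence in `out Xe`, and by composability such an output is not an output of the
system, so some opening action exists (`exists_opening`).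
-/

namespace EcoTesting

/-! ### Labelled transition systems -/

namespace LTS

variable {Act : Type u}

theorem ObsWeak.of_silent {s : LTS.{u, v} Act} {q q₁ q' : s.Q} {σ : List (ObsLabel Act)}
    (h : s.Silent q q₁) (h' : s.ObsWeak q₁ σ q') : s.ObsWeak q σ q' := by
  cases σ with
  | nil => exact Relation.ReflTransGen.trans h h'
  | cons x σ =>
    obtain ⟨a, b, h₁, h₂, h₃⟩ := h'
    exact ⟨a, b, Relation.ReflTransGen.trans h h₁, h₂, h₃⟩

theorem ObsWeak.tail_tau {s : LTS.{u, v} Act} {σ : List (ObsLabel Act)} {q q' q'' : s.Q}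
    (h : s.ObsWeak q σ q') (h' : s.T q' none q'') : s.ObsWeak q σ q'' := by
  induction σ generalizing q with
  | nil => exact Relation.ReflTransGen.tail h h'
  | cons x σ ih =>
    obtain ⟨a, b, h₁, h₂, h₃⟩ := h
    exact ⟨a, b, h₁, h₂, ih h₃⟩

theorem exists_weak_iff {s : LTS.{u, v} Act} {q q' : s.Q} :
    (∃ σ, s.Weak q σ q') ↔ Relation.ReflTransGen (fun a b => ∃ x, s.T a x b) q q' := by
  have hsilent : ∀ {a b}, s.Silent a b →
      Relation.ReflTransGen (fun a b => ∃ x, s.T a x b) a b := fun h =>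
    Relation.ReflTransGen.mono (fun _ _ hab => ⟨none, hab⟩) _ _ h
  constructor
  · rintro ⟨σ, h⟩
    induction σ generalizing q with
    | nil => exact hsilent h
    | cons x σ ih =>
      obtain ⟨a, b, h₁, h₂, h₃⟩ := h
      exact (hsilent h₁).trans (.head ⟨some x, h₂⟩ (ih h₃))
  · intro h
    induction h using Relation.ReflTransGen.head_induction_on with
    | refl => exact ⟨[], .refl⟩
    | head h _ ih =>
      obtain ⟨σ, hσ⟩ := ih
      obtain ⟨_ | x, hx⟩ := h
      · exact ⟨σ, ObsWeak.of_silent (.single hx) hσ⟩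
      · exact ⟨x :: σ, _, _, .refl, hx, hσ⟩

/-- `X` is closed under internal steps. -/
def SilentClosed (s : LTS.{u, v} Act) (X : Set s.Q) : Prop :=
  ∀ q ∈ X, ∀ q', s.T q none q' → q' ∈ X

theorem silentClosed_after (s : LTS.{u, v} Act) (X : Set s.Q) (σ : List (ObsLabel Act)) :
    s.SilentClosed (s.after X σ) := fun _ ⟨p, hp, h⟩ _ hq => ⟨p, hp, h.tail_tau hq⟩

theorem SilentClosed.mem_of_silent {s : LTS.{u, v} Act} {X : Set s.Q} (hX : s.SilentClosed X)
    {q q' : s.Q} (hq : q ∈ X) (h : s.Silent q q') : q' ∈ X := by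
  induction h with
  | refl => exact hq
  | tail _ h ih => exact hX _ ih _ h

theorem mem_after_of_obsStep {s : LTS.{u, v} Act} {X : Set s.Q} {q q' : s.Q} {x : ObsLabel Act}
    (hq : q ∈ X) (h : s.ObsStep q x q') : q' ∈ s.after X [x] :=
  ⟨q, hq, q, q', .refl, h, .refl⟩

theorem IsLTS.exists_silent_stable {s : LTS.{u, v} Act} (hs : s.IsLTS) (q : s.Q) :
    ∃ q', s.Silent q q' ∧ ∀ q'', ¬ s.T q' none q'' := by
  by_contra! h
  choose f hf using h
  let g : ℕ → {q' // s.Silent q q'} := fun n =>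
    Nat.rec ⟨q, .refl⟩ (fun _ p => ⟨f p.1 p.2, Relation.ReflTransGen.tail p.2 (hf p.1 p.2)⟩) n
  exact hs.strongly_converging ⟨fun n => (g n).1, fun n => hf (g n).1 (g n).2⟩

theorem IsLTS.out_nonempty {s : LTS.{u, v} Act} (hs : s.IsLTS) {X : Set s.Q}
    (hX : s.SilentClosed X) (hne : X.Nonempty) : (s.out X).Nonempty := by
  obtain ⟨q, hq⟩ := hne
  obtain ⟨q', h, hst⟩ := hs.exists_silent_stable q
  have hq' := hX.mem_of_silent hq h
  by_cases hquiet : s.Quiescent q'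
  · exact ⟨.delta, .inl rfl, q', hq', q', rfl, hquiet⟩
  · obtain ⟨x, hx, q'', hT⟩ : ∃ x ∈ s.U, ∃ q'', s.T q' (some x) q'' := by
      by_contra! hcon
      exact hquiet ⟨hcon, hst⟩
    exact ⟨.act x, .inr ⟨x, hx, rfl⟩, q', hq', q'', hT⟩

theorem act_mem_out_iff {s : LTS.{u, v} Act} {X : Set s.Q} {a : Act} :
    .act a ∈ s.out X ↔ a ∈ s.U ∧ ∃ q ∈ X, ∃ q', s.T q (some a) q' := by
  simp [out, Udelta, ObsStep]

theorem after_nonempty_of_mem_out {s : LTS.{u, v} Act} {X : Set s.Q} {x : ObsLabel Act}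
    (h : x ∈ s.out X) : (s.after X [x]).Nonempty := by
  obtain ⟨-, q, hq, q', h⟩ := h
  exact ⟨q', mem_after_of_obsStep hq h⟩

theorem after_nonempty_of_mem_inp {s : LTS.{u, v} Act} {X : Set s.Q} {a : Act}
    (hX : X.Nonempty) (h : a ∈ s.inp X) : (s.after X [.act a]).Nonempty := by
  obtain ⟨q, hq⟩ := hX
  obtain ⟨q', h⟩ := h.2 q hq
  exact ⟨q', q, hq, h⟩

theorem IsInputEnabled.inp_eq {s : LTS.{u, v} Act} (hs : s.IsInputEnabled) (X : Set s.Q) :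
    s.inp X = s.I :=
  Set.ext fun ℓ => ⟨fun h => h.1, fun h => ⟨h, fun q _ => hs.2 q ℓ h⟩⟩

end LTS

/-! ### Transitions of behaviour expressions -/

namespace BExp

variable {Λ : Type u} {It : Set Λ}

/-- `B` is one of the constants `pass` and `fail`. -/
def IsConst (B : BExp Λ) : Prop := B = pass ∨ B = fail

theorem step_pass_iff {ℓ : Λ} {C : BExp Λ} : Step It pass ℓ C ↔ ℓ ∈ It ∧ C = pass := by
  constructor
  · rintro ⟨⟩
    exact ⟨‹_›, rfl⟩
  · rintro ⟨h, rfl⟩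
    exact .pass h

theorem step_fail_iff {ℓ : Λ} {C : BExp Λ} : Step It fail ℓ C ↔ ℓ ∈ It ∧ C = fail := by
  constructor
  · rintro ⟨⟩
    exact ⟨‹_›, rfl⟩
  · rintro ⟨h, rfl⟩
    exact .fail h

theorem step_seq_iff {ℓ x : Λ} {B C : BExp Λ} : Step It (seq ℓ B) x C ↔ x = ℓ ∧ C = B := by
  constructor
  · rintro ⟨⟩
    exact ⟨rfl, rfl⟩
  · rintro ⟨rfl, rfl⟩
    exact .seq _ _

theorem step_sum_iff {ι : Type u} {F : ι → BExp Λ} {x : Λ} {C : BExp Λ} :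
    Step It (sum F) x C ↔ ∃ k, Step It (F k) x C := by
  constructor
  · rintro ⟨⟩
    exact ⟨_, ‹_›⟩
  · rintro ⟨k, h⟩
    exact .sum F k h

theorem step_choice_iff {B₁ B₂ : BExp Λ} {x : Λ} {C : BExp Λ} :
    Step It (choice B₁ B₂) x C ↔ Step It B₁ x C ∨ Step It B₂ x C := by
  rw [choice, step_sum_iff]
  constructor
  · rintro ⟨⟨_ | _⟩, h⟩
    · exact .inr h
    · exact .inl h
  · rintro (h | h)
    · exact ⟨⟨true⟩, h⟩
    · exact ⟨⟨false⟩, h⟩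

theorem IsConst.of_step {C C' : BExp Λ} {ℓ : Λ} (hC : C.IsConst) (h : Step It C ℓ C') :
    C'.IsConst := by
  rcases hC with rfl | rfl
  · exact .inl (step_pass_iff.1 h).2
  · exact .inr (step_fail_iff.1 h).2

/-- Steps between expressions other than the constants descend structurally. -/
theorem acc_step (It : Set Λ) (C : BExp Λ) :
    Acc (fun C' C : BExp Λ => ¬ C'.IsConst ∧ ∃ ℓ, Step It C ℓ C') C := by
  induction C with
  | pass => exact ⟨_, fun C' ⟨h, ℓ, hs⟩ => (h (.inl (step_pass_iff.1 hs).2)).elim⟩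
  | fail => exact ⟨_, fun C' ⟨h, ℓ, hs⟩ => (h (.inr (step_fail_iff.1 hs).2)).elim⟩
  | seq ℓ B ih => exact ⟨_, fun C' ⟨_, ℓ', hs⟩ => (step_seq_iff.1 hs).2 ▸ ih⟩
  | sum F ih =>
    refine ⟨_, fun C' ⟨h, ℓ, hs⟩ => ?_⟩
    obtain ⟨k, hk⟩ := step_sum_iff.1 hs
    exact (ih k).inv ⟨h, ℓ, hk⟩

@[simp] theorem occ_snd (σ : List Λ) (C : BExp Λ) : (occ σ C).2 = C := by
  cases C <;> rfl

theorem occ_eq {C : BExp Λ} (σ : List Λ) (h : ¬ C.IsConst) : occ σ C = (σ, C) := by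
  cases C with
  | pass => exact (h (.inl rfl)).elim
  | fail => exact (h (.inr rfl)).elim
  | seq => rfl
  | sum => rfl

theorem IsState.eq_occ {B : BExp Λ} {p : List Λ × BExp Λ} (h : IsState It B p) :
    p = occ p.1 p.2 := by
  have key : ∀ (σ : List Λ) (C : BExp Λ), occ σ C = occ (occ σ C).1 (occ σ C).2 := by
    intro σ C
    cases C <;> rfl
  cases h with
  | root => exact key _ _
  | pass => rfl
  | fail => rfl
  | step => exact key _ _

theorem IsState.eq_of_snd_eq {B : BExp Λ} {p p' : List Λ × BExp Λ} (h : IsState It B p)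
    (h' : IsState It B p') (hc : p.2.IsConst) (heq : p.2 = p'.2) : p = p' := by
  rw [h.eq_occ, h'.eq_occ, ← heq]
  rcases hc with hc | hc <;> rw [hc] <;> rfl

end BExp

/-! ### Outcomes of the test generation -/

section Outcomes

variable {Act : Type u} {e : LTS.{u, v} Act} {Ii Ui : Set Act}

/-- `Opening e Ii Ui X x Y`: an outcome of `GenEcoTest` on `X` may offer the label `x`, besides the
responses to outputs of the system under test, and continue with an outcome on `Y`. The
constructors are the cases (B) to (E) of the procedure. -/
inductive Opening (e : LTS.{u, v} Act) (Ii Ui : Set Act) (X : Set e.Q) :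
    TestLabel Act → Set e.Q → Prop
  | input (ℓ : Act) : (.act ℓ ∈ e.out X ∨ ℓ ∈ e.inp X) → ℓ ∈ Ii →
      Opening e Ii Ui X (.act ℓ) (e.after X [.act ℓ])
  | observe : .delta ∈ e.out X → Opening e Ii Ui X .theta (e.after X [.delta])
  | environment (ℓ : Act) : (.act ℓ ∈ e.out X ∨ ℓ ∈ e.inp X) → ℓ ∉ Ii ∪ Ui →
      Opening e Ii Ui X (.act ℓ) (e.after X [.act ℓ])
  | system (ℓ : Act) : ℓ ∈ Ii → ℓ ∉ e.L → Opening e Ii Ui X (.act ℓ) X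

theorem genEcoTest_iff {X : Set e.Q} {C : BExp (TestLabel Act)} :
    GenEcoTest e Ii Ui X C ↔ C = .pass ∨ ∃ x Y B F, Opening e Ii Ui X x Y ∧
      GenEcoTest e Ii Ui Y B ∧ (∀ k, GenEcoTest e Ii Ui (e.after X [.act k.1]) (F k)) ∧
      C = .choice (.seq x B) (inputResponse e Ui X F) := by
  constructor
  · intro h
    cases h with
    | passed => exact .inl rfl
    | input _ ℓ B F h₁ h₂ hB hF => exact .inr ⟨_, _, B, F, .input ℓ h₁ h₂, hB, hF, rfl⟩
    | observe _ B F h₁ hB hF => exact .inr ⟨_, _, B, F, .observe h₁, hB, hF, rfl⟩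
    | environment _ ℓ B F h₁ h₂ hB hF =>
      exact .inr ⟨_, _, B, F, .environment ℓ h₁ h₂, hB, hF, rfl⟩
    | system _ ℓ B F h₁ h₂ hB hF => exact .inr ⟨_, _, B, F, .system ℓ h₁ h₂, hB, hF, rfl⟩
  · rintro (rfl | ⟨x, Y, B, F, hO, hB, hF, rfl⟩)
    · exact .passed X
    · cases hO with
      | input ℓ h₁ h₂ => exact .input X ℓ B F h₁ h₂ hB hF
      | observe h₁ => exact .observe X B F h₁ hB hF
      | environment ℓ h₁ h₂ => exact .environment X ℓ B F h₁ h₂ hB hF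
      | system ℓ h₁ h₂ => exact .system X ℓ B F h₁ h₂ hB hF

theorem step_choice_inputResponse_iff {It : Set (TestLabel Act)} {X : Set e.Q} {x y : TestLabel Act}
    {B C : BExp (TestLabel Act)} {F : {k : Act // k ∈ Ui ∩ e.inp X} → BExp (TestLabel Act)} :
    BExp.Step It (.choice (.seq x B) (inputResponse e Ui X F)) y C ↔ (y = x ∧ C = B) ∨
      (∃ a ∈ (Ui ∩ e.I) \ e.inp X, y = .act a ∧ C = .fail) ∨ ∃ k, y = .act k.1 ∧ C = F k := by
  simp only [inputResponse, BExp.step_choice_iff, BExp.step_sum_iff, BExp.step_seq_iff,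
    Subtype.exists, exists_prop]

theorem act_mem_labels_iff {a : Act} :
    .act a ∈ testInputs e Ui ∪ testOutputs e Ii Ui ↔ a ∈ e.L ∨ a ∈ Ii := by
  simp only [testInputs, testOutputs, LTS.L, Set.mem_union, Set.mem_image, TestLabel.act.injEq,
    exists_eq_right, Set.mem_inter_iff, Set.mem_singleton_iff, Set.mem_sdiff, reduceCtorEq]
  tauto

theorem act_mem_testInputs_iff {a : Act} : .act a ∈ testInputs e Ui ↔ a ∈ Ui ∧ a ∈ e.I := by
  simp [testInputs]

theorem theta_mem_testInputs : .theta ∈ testInputs e Ui := .inr rfl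

theorem Opening.notMem_Ui (hIU : Disjoint Ii Ui) {X Y : Set e.Q} {a : Act}
    (h : Opening e Ii Ui X (.act a) Y) : a ∉ Ui := by
  cases h with
  | input _ _ h => exact Set.disjoint_left.1 hIU h
  | environment _ _ h => exact fun ha => h (.inr ha)
  | system _ h => exact Set.disjoint_left.1 hIU h

theorem Opening.mem_labels {X Y : Set e.Q} {x : TestLabel Act} (h : Opening e Ii Ui X x Y) :
    x ∈ testInputs e Ui ∪ testOutputs e Ii Ui := by
  cases h with
  | input _ _ h => exact act_mem_labels_iff.2 (.inr h)
  | observe => exact .inl theta_mem_testInputs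
  | environment _ h _ =>
    refine act_mem_labels_iff.2 (.inl ?_)
    rcases h with h | h
    · exact .inr (LTS.act_mem_out_iff.1 h).1
    · exact .inl h.1
  | system _ h => exact act_mem_labels_iff.2 (.inr h)

/-- An expression that a state of a generated test case can carry: `fail`, or an outcome of
`GenEcoTest` on some set of states. -/
def IsOutcome (e : LTS.{u, v} Act) (Ii Ui : Set Act) (C : BExp (TestLabel Act)) : Prop :=
  C = .fail ∨ ∃ X, GenEcoTest e Ii Ui X C

theorem IsOutcome.of_step {C C' : BExp (TestLabel Act)} {x : TestLabel Act}
    (hC : IsOutcome e Ii Ui C) (h : BExp.Step (testInputs e Ui) C x C') :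
    IsOutcome e Ii Ui C' := by
  rcases hC with rfl | ⟨X, hX⟩
  · exact .inl (BExp.step_fail_iff.1 h).2
  · rcases genEcoTest_iff.1 hX with rfl | ⟨y, Y, B, F, -, hB, hF, rfl⟩
    · exact .inr ⟨X, (BExp.step_pass_iff.1 h).2 ▸ hX⟩
    · rcases step_choice_inputResponse_iff.1 h with ⟨-, rfl⟩ | ⟨a, -, -, rfl⟩ | ⟨k, -, rfl⟩
      · exact .inr ⟨Y, hB⟩
      · exact .inl rfl
      · exact .inr ⟨_, hF k⟩

theorem IsOutcome.step_unique (hIU : Disjoint Ii Ui) {C C₁ C₂ : BExp (TestLabel Act)}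
    {x : TestLabel Act} (hC : IsOutcome e Ii Ui C) (h₁ : BExp.Step (testInputs e Ui) C x C₁)
    (h₂ : BExp.Step (testInputs e Ui) C x C₂) : C₁ = C₂ := by
  rcases hC with rfl | ⟨X, hX⟩
  · rw [(BExp.step_fail_iff.1 h₁).2, (BExp.step_fail_iff.1 h₂).2]
  · rcases genEcoTest_iff.1 hX with rfl | ⟨y, Y, B, F, hO, -, -, rfl⟩
    · rw [(BExp.step_pass_iff.1 h₁).2, (BExp.step_pass_iff.1 h₂).2]
    · rcases step_choice_inputResponse_iff.1 h₁ with ⟨rfl, rfl⟩ | ⟨a, ha, rfl, rfl⟩ | ⟨k, rfl, rfl⟩ <;>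
        rcases step_choice_inputResponse_iff.1 h₂ with ⟨h, rfl⟩ | ⟨b, hb, h, rfl⟩ | ⟨l, h, rfl⟩
      · rfl
      · subst h
        exact (hO.notMem_Ui hIU hb.1.1).elim
      · subst h
        exact (hO.notMem_Ui hIU l.2.1).elim
      · subst h
        exact (hO.notMem_Ui hIU ha.1.1).elim
      · rfl
      · cases h
        exact (ha.2 l.2.2).elim
      · subst h
        exact (hO.notMem_Ui hIU k.2.1).elim
      · cases h
        exact (hb.2 k.2.2).elim
      · rw [Subtype.ext (TestLabel.act.inj h)]

theorem IsOutcome.mem_labels {C C' : BExp (TestLabel Act)} {x : TestLabel Act}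
    (hC : IsOutcome e Ii Ui C) (h : BExp.Step (testInputs e Ui) C x C') :
    x ∈ testInputs e Ui ∪ testOutputs e Ii Ui := by
  rcases hC with rfl | ⟨X, hX⟩
  · exact .inl (BExp.step_fail_iff.1 h).1
  · rcases genEcoTest_iff.1 hX with rfl | ⟨y, Y, B, F, hO, -, -, rfl⟩
    · exact .inl (BExp.step_pass_iff.1 h).1
    · rcases step_choice_inputResponse_iff.1 h with ⟨rfl, -⟩ | ⟨a, ha, rfl, -⟩ | ⟨k, rfl, -⟩
      · exact hO.mem_labels
      · exact .inl (act_mem_testInputs_iff.2 ha.1)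
      · exact .inl (act_mem_testInputs_iff.2 ⟨k.2.1, k.2.2.1⟩)

theorem disjoint_testInputs_testOutputs (he : e.IsLTS) (hIU : Disjoint Ii Ui) :
    Disjoint (testInputs e Ui) (testOutputs e Ii Ui) := by
  rw [Set.disjoint_left]
  rintro (a | _) h₁ ⟨b, hb, h⟩
  · cases h
    obtain ⟨h₁, h₂⟩ := act_mem_testInputs_iff.1 h₁
    rcases hb with (hb | hb) | hb
    · exact Set.disjoint_left.1 he.disjoint h₂ hb
    · exact hb.2 h₁
    · exact Set.disjoint_left.1 hIU hb.1 h₁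
  · cases h

/-- An outcome offers at most one output of the test case, namely its opening action. -/
theorem IsOutcome.output_unique (he : e.IsLTS) (hIU : Disjoint Ii Ui)
    {C C₁ C₂ : BExp (TestLabel Act)} {x y : TestLabel Act} (hC : IsOutcome e Ii Ui C)
    (h₁ : BExp.Step (testInputs e Ui) C x C₁) (h₂ : BExp.Step (testInputs e Ui) C y C₂)
    (hx : x ∈ testOutputs e Ii Ui) (hy : y ∈ testOutputs e Ii Ui) : x = y := by
  have hd : ∀ z ∈ testOutputs e Ii Ui, z ∉ testInputs e Ui := fun z hz hz' =>
    Set.disjoint_left.1 (disjoint_testInputs_testOutputs he hIU) hz' hz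
  rcases hC with rfl | ⟨X, hX⟩
  · exact (hd _ hx (BExp.step_fail_iff.1 h₁).1).elim
  · rcases genEcoTest_iff.1 hX with rfl | ⟨z, Y, B, F, hO, -, -, rfl⟩
    · exact (hd _ hx (BExp.step_pass_iff.1 h₁).1).elim
    · have key : ∀ {w D}, BExp.Step (testInputs e Ui)
          (.choice (.seq z B) (inputResponse e Ui X F)) w D → w ∈ testOutputs e Ii Ui → w = z := by
        intro w D h hw
        rcases step_choice_inputResponse_iff.1 h with ⟨rfl, -⟩ | ⟨a, ha, rfl, -⟩ | ⟨k, rfl, -⟩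
        · rfl
        · exact (hd _ hw (act_mem_testInputs_iff.2 ha.1)).elim
        · exact (hd _ hw (act_mem_testInputs_iff.2 ⟨k.2.1, k.2.2.1⟩)).elim
      rw [key h₁ hx, key h₂ hy]

theorem IsOutcome.exists_step {C : BExp (TestLabel Act)} {x : TestLabel Act}
    (hC : IsOutcome e Ii Ui C) (hx : x ∈ testInputs e Ui) (hθ : x ≠ .theta) :
    ∃ C', BExp.Step (testInputs e Ui) C x C' := by
  rcases hC with rfl | ⟨X, hX⟩
  · exact ⟨_, .fail hx⟩
  · rcases genEcoTest_iff.1 hX with rfl | ⟨z, Y, B, F, hO, -, -, rfl⟩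
    · exact ⟨_, .pass hx⟩
    · simp only [step_choice_inputResponse_iff]
      rcases x with a | _
      · have ha := act_mem_testInputs_iff.1 hx
        by_cases hin : a ∈ e.inp X
        · exact ⟨_, .inr (.inr ⟨⟨a, ha.1, hin⟩, rfl, rfl⟩)⟩
        · exact ⟨_, .inr (.inl ⟨a, ⟨ha, hin⟩, rfl, rfl⟩)⟩
      · exact (hθ rfl).elim

/-! ### Generated transition systems are test cases -/

open BExp in
theorem BExp.IsState.isOutcome {B : BExp (TestLabel Act)} (hB : IsOutcome e Ii Ui B)
    {p : List (TestLabel Act) × BExp (TestLabel Act)} (h : IsState (testInputs e Ui) B p) :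
    IsOutcome e Ii Ui p.2 := by
  induction h with
  | root => simpa using hB
  | pass => exact .inr ⟨∅, .passed _⟩
  | fail => exact .inl rfl
  | step _ hs ih => simpa using ih.of_step hs

open BExp in
theorem BExp.IsState.history_mem_labels {B : BExp (TestLabel Act)} (hB : IsOutcome e Ii Ui B)
    {p : List (TestLabel Act) × BExp (TestLabel Act)} (h : IsState (testInputs e Ui) B p) :
    ∀ x ∈ p.1, x ∈ testInputs e Ui ∪ testOutputs e Ii Ui := by
  have key : ∀ (σ : List (TestLabel Act)) (C : BExp (TestLabel Act)), ∀ x ∈ (occ σ C).1, x ∈ σ := by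
    intro σ C
    cases C <;> simp [occ]
  induction h with
  | root =>
    intro x hx
    simpa using key _ _ x hx
  | pass => simp
  | fail => simp
  | @step σ C C' ℓ hp hs ih =>
    intro x hx
    rcases List.mem_cons.1 (key _ _ x hx) with rfl | hx
    · exact IsOutcome.mem_labels (IsState.isOutcome hB hp) hs
    · exact ih x hx

open BExp in
/-- A history leads to at most one occurrence of an expression other than the constants. -/
theorem BExp.IsState.eq_of_history_eq (hIU : Disjoint Ii Ui) {B : BExp (TestLabel Act)}
    (hB : IsOutcome e Ii Ui B) {p p' : List (TestLabel Act) × BExp (TestLabel Act)}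
    (h : IsState (testInputs e Ui) B p) (h' : IsState (testInputs e Ui) B p')
    (hp : ¬ p.2.IsConst) (hp' : ¬ p'.2.IsConst) (heq : p.1 = p'.1) : p = p' := by
  induction h generalizing p' with
  | root =>
    rw [occ_snd] at hp
    rw [occ_eq _ hp] at heq ⊢
    cases h' with
    | root => rw [occ_eq _ hp]
    | pass => exact (hp' (.inl rfl)).elim
    | fail => exact (hp' (.inr rfl)).elim
    | step _ _ =>
      rw [occ_snd] at hp'
      rw [occ_eq _ hp'] at heq
      cases heq
  | pass => exact (hp (.inl rfl)).elim
  | fail => exact (hp (.inr rfl)).elim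
  | @step σ C C' ℓ hC hs ih =>
    rw [occ_snd] at hp
    rw [occ_eq _ hp] at heq ⊢
    cases h' with
    | root =>
      rw [occ_snd] at hp'
      rw [occ_eq _ hp'] at heq
      cases heq
    | pass => exact (hp' (.inl rfl)).elim
    | fail => exact (hp' (.inr rfl)).elim
    | @step τ D D' m hD ht =>
      rw [occ_snd] at hp'
      rw [occ_eq _ hp'] at heq ⊢
      obtain ⟨rfl, rfl⟩ := List.cons.inj heq
      cases ih hD (fun hc => hp (hc.of_step hs)) (fun hc => hp' (hc.of_step ht)) rfl
      rw [IsOutcome.step_unique hIU (IsState.isOutcome hB hC) hs ht]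

open BExp in
theorem isTerminal_toTestLTS_iff {It Ut : Set (TestLabel Act)} {B : BExp (TestLabel Act)}
    {p : (B.toTestLTS It Ut).Q} : (B.toTestLTS It Ut).IsTerminal p ↔ p.1.2.IsConst := by
  constructor
  · rintro (rfl | rfl)
    · exact .inl rfl
    · exact .inr rfl
  · rintro (h | h)
    · exact .inl (Subtype.ext (p.2.eq_of_snd_eq .pass (.inl h) h))
    · exact .inr (Subtype.ext (p.2.eq_of_snd_eq .fail (.inr h) h))

theorem countable_labels (he : e.IsLTS) (hIi : Ii.Countable) (hUi : Ui.Countable) :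
    (testInputs e Ui ∪ testOutputs e Ii Ui).Countable := by
  have h₁ : (testInputs e Ui).Countable :=
    ((hUi.mono Set.inter_subset_left).image _).union (Set.countable_singleton _)
  have h₂ : (testOutputs e Ii Ui).Countable :=
    ((he.countable_U.union (he.countable_I.mono Set.sdiff_subset)).union
      (hIi.mono Set.sdiff_subset)).image _
  exact h₁.union h₂

open BExp in
theorem countable_states (he : e.IsLTS) (hIi : Ii.Countable) (hUi : Ui.Countable)
    (hIU : Disjoint Ii Ui) {B : BExp (TestLabel Act)} (hB : IsOutcome e Ii Ui B) :
    Countable {p // IsState (testInputs e Ui) B p} := by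
  have hL := countable_labels he hIi hUi
  have hlist : {σ : List (TestLabel Act) |
      ∀ x ∈ σ, x ∈ testInputs e Ui ∪ testOutputs e Ii Ui}.Countable := by
    have := hL.to_subtype
    rw [← Set.range_list_map_coe]
    exact Set.countable_range _
  have h₁ : {p | IsState (testInputs e Ui) B p ∧ ¬ p.2.IsConst}.Countable := by
    refine Set.MapsTo.countable_of_injOn (f := Prod.fst) (t := {σ : List (TestLabel Act) |
      ∀ x ∈ σ, x ∈ testInputs e Ui ∪ testOutputs e Ii Ui})
      (fun p hp => IsState.history_mem_labels hB hp.1) ?_ hlist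
    exact fun p hp p' hp' h => IsState.eq_of_history_eq hIU hB hp.1 hp'.1 hp.2 hp'.2 h
  have h₂ : ({([], BExp.pass), ([], BExp.fail)} :
      Set (List (TestLabel Act) × BExp (TestLabel Act))).Countable := (Set.toFinite _).countable
  refine Set.Countable.to_subtype ((h₁.union h₂).mono fun p hp => ?_)
  by_cases hc : p.2.IsConst
  · rcases hc with hc | hc
    · exact .inr (.inl (hp.eq_of_snd_eq .pass (.inl hc) hc))
    · exact .inr (.inr (hp.eq_of_snd_eq .fail (.inr hc) hc))
  · exact .inl ⟨hp, hc⟩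

open BExp in
theorem toTestLTS_trans_unique (hIU : Disjoint Ii Ui) {Ut : Set (TestLabel Act)}
    {B : BExp (TestLabel Act)} (hB : IsOutcome e Ii Ui B)
    {p p₁ p₂ : (B.toTestLTS (testInputs e Ui) Ut).Q} {x : Option (TestLabel Act)}
    (h₁ : (B.toTestLTS (testInputs e Ui) Ut).T p x p₁)
    (h₂ : (B.toTestLTS (testInputs e Ui) Ut).T p x p₂) : p₁ = p₂ := by
  obtain ⟨ℓ, C₁, rfl, hs₁, hp₁⟩ := h₁
  obtain ⟨ℓ', C₂, h, hs₂, hp₂⟩ := h₂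
  cases h
  refine Subtype.ext ?_
  rw [hp₁, hp₂, IsOutcome.step_unique hIU (IsState.isOutcome hB p.2) hs₁ hs₂]

open BExp in
theorem toTestLTS_isLTS (he : e.IsLTS) (hIi : Ii.Countable) (hUi : Ui.Countable)
    (hIU : Disjoint Ii Ui) {B : BExp (TestLabel Act)} (hB : IsOutcome e Ii Ui B) :
    (B.toTestLTS (testInputs e Ui) (testOutputs e Ii Ui)).toLTS.IsLTS where
  countable_Q := countable_states he hIi hUi hIU hB
  countable_I := (countable_labels he hIi hUi).mono Set.subset_union_left
  countable_U := (countable_labels he hIi hUi).mono Set.subset_union_right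
  disjoint := disjoint_testInputs_testOutputs he hIU
  label_mem := by
    rintro p ℓ p' ⟨_, C, h, hs, -⟩
    cases h
    exact IsOutcome.mem_labels (IsState.isOutcome hB p.2) hs
  strongly_converging := by
    rintro ⟨f, hf⟩
    obtain ⟨_, _, h, -⟩ := hf 0
    cases h
  image_finite := by
    have hsilent : ∀ {p p'}, (B.toTestLTS (testInputs e Ui) (testOutputs e Ii Ui)).Silent p p' →
        p = p' := by
      intro p p' h
      induction h with
      | refl => rfl
      | tail _ h _ =>
        obtain ⟨_, _, h, -⟩ := h
        cases h
    intro p σ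
    refine Set.Subsingleton.finite ?_
    induction σ generalizing p with
    | nil =>
      intro p₁ h₁ p₂ h₂
      exact (hsilent h₁).symm.trans (hsilent h₂)
    | cons x σ ih =>
      rintro p₁ ⟨a₁, b₁, h₁, hs₁, hw₁⟩ p₂ ⟨a₂, b₂, h₂, hs₂, hw₂⟩
      obtain rfl := hsilent h₁
      obtain rfl := hsilent h₂
      obtain rfl := toTestLTS_trans_unique hIU hB hs₁ hs₂
      exact ih _ hw₁ hw₂

open BExp in
theorem toTestLTS_isTestCase (he : e.IsLTS) (hIi : Ii.Countable) (hUi : Ui.Countable)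
    (hIU : Disjoint Ii Ui) {B : BExp (TestLabel Act)} (hB : IsOutcome e Ii Ui B) :
    (B.toTestLTS (testInputs e Ui) (testOutputs e Ii Ui)).IsTestCase where
  isLTS := toTestLTS_isLTS he hIi hUi hIU hB
  tree := by
    rintro ⟨p, hp⟩ hterm hroot
    replace hterm := mt isTerminal_toTestLTS_iff.2 hterm
    dsimp only at hterm
    cases hp with
    | root => exact (hroot rfl).elim
    | pass => exact (hterm (.inl rfl)).elim
    | fail => exact (hterm (.inr rfl)).elim
    | @step σ C C' ℓ hC hs =>
      rw [occ_snd] at hterm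
      refine ⟨(⟨(σ, C), hC⟩, some ℓ), ⟨ℓ, C', rfl, hs, rfl⟩, ?_⟩
      rintro ⟨⟨⟨τ, D⟩, hD⟩, x⟩ ⟨m, D', rfl, ht, hocc⟩
      change occ (ℓ :: σ) C' = occ (m :: τ) D' at hocc
      have hCD : C' = D' := by simpa using congrArg Prod.snd hocc
      subst hCD
      rw [occ_eq _ hterm, occ_eq _ hterm] at hocc
      obtain ⟨rfl, rfl⟩ := List.cons.inj (Prod.mk.inj hocc).1
      cases IsState.eq_of_history_eq hIU hB hC hD (fun hc => hterm (hc.of_step hs))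
        (fun hc => hterm (hc.of_step ht)) rfl
      rfl
  finite_behaviour := by
    rintro ⟨f, hf⟩
    have hwf : ∀ C, Acc (fun C' C => ¬ C'.IsConst ∧ ∃ ℓ, Step (testInputs e Ui) C ℓ C') C →
        ∀ n, (f n).1.2 ≠ C := by
      intro C hC
      induction hC with
      | intro C _ ih =>
        rintro n rfl
        obtain ⟨-, x, ℓ, C', -, hs, hocc⟩ := hf n
        have hC' : (f (n + 1)).1.2 = C' := by rw [hocc, occ_snd]
        refine ih C' ⟨?_, ℓ, hs⟩ (n + 1) hC'
        rw [← hC', ← isTerminal_toTestLTS_iff]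
        exact (hf (n + 1)).1
    exact hwf _ (acc_step _ _) 0 rfl
  pass_ne_fail := fun h => by cases congrArg (fun p => p.1.2) h
  pass_loops := by
    intro x p
    constructor
    · rintro ⟨ℓ, C, rfl, hs, hp⟩
      obtain ⟨hℓ, rfl⟩ := step_pass_iff.1 hs
      exact ⟨⟨ℓ, hℓ, rfl⟩, Subtype.ext hp⟩
    · rintro ⟨⟨ℓ, hℓ, rfl⟩, rfl⟩
      exact ⟨ℓ, .pass, rfl, .pass hℓ, rfl⟩
  fail_loops := by
    intro x p
    constructor
    · rintro ⟨ℓ, C, rfl, hs, hp⟩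
      obtain ⟨hℓ, rfl⟩ := step_fail_iff.1 hs
      exact ⟨⟨ℓ, hℓ, rfl⟩, Subtype.ext hp⟩
    · rintro ⟨⟨ℓ, hℓ, rfl⟩, rfl⟩
      exact ⟨ℓ, .fail, rfl, .fail hℓ, rfl⟩
  theta_mem := theta_mem_testInputs
  one_output := by
    intro p x y p₁ p₂ hx hy h₁ h₂
    have hxy : x = y := by
      obtain ⟨_, C₁, h, hs₁, -⟩ := h₁
      cases h
      obtain ⟨_, C₂, h, hs₂, -⟩ := h₂
      cases h
      exact IsOutcome.output_unique he hIU (IsState.isOutcome hB p.2) hs₁ hs₂ hx hy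
    subst hxy
    exact ⟨rfl, toTestLTS_trans_unique hIU hB h₁ h₂⟩
  receptive := by
    intro p x hx hθ
    obtain ⟨C, hC⟩ := IsOutcome.exists_step (IsState.isOutcome hB p.2) hx hθ
    have hT : (B.toTestLTS (testInputs e Ui) (testOutputs e Ii Ui)).T p (some x)
        ⟨occ (x :: p.1.1) C, .step p.2 hC⟩ := ⟨x, C, rfl, hC, rfl⟩
    exact ⟨_, hT, fun p' hp' => toTestLTS_trans_unique hIU hB hp' hT⟩
  no_tau := by
    rintro p p' ⟨_, _, h, -⟩
    cases h

end Outcomes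

/-! ### Test execution on expressions -/

section Execution

variable {Act : Type u}

/-- The test execution of an expression, as a test case with inputs `It` and outputs `Ut`, on `i`,
without the histories that distinguish occurrences of an expression and without labels. -/
inductive ExprStep (It Ut : Set (TestLabel Act)) (i : LTS.{u, w} Act) :
    BExp (TestLabel Act) × i.Q → BExp (TestLabel Act) × i.Q → Prop
  | tau {C : BExp (TestLabel Act)} {q q' : i.Q} : i.T q none q' → ExprStep It Ut i (C, q) (C, q')
  | sut {C : BExp (TestLabel Act)} {q q' : i.Q} {a : Act} : i.T q (some a) q' → a ∈ i.L →
      .act a ∉ It ∪ Ut → ExprStep It Ut i (C, q) (C, q')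
  | test {C C' : BExp (TestLabel Act)} {q : i.Q} {a : Act} : C.Step It (.act a) C' →
      .act a ∈ It ∪ Ut → a ∉ i.L → ExprStep It Ut i (C, q) (C', q)
  | sync {C C' : BExp (TestLabel Act)} {q q' : i.Q} {a : Act} : C.Step It (.act a) C' →
      i.T q (some a) q' → a ∈ i.L → .act a ∈ It ∪ Ut → ExprStep It Ut i (C, q) (C', q')
  | theta {C C' : BExp (TestLabel Act)} {q q' : i.Q} : C.Step It .theta C' →
      i.ObsStep q .delta q' → ExprStep It Ut i (C, q) (C', q')

/-- The execution of `B` from the state `q` of `i` can reach `fail`. -/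
def CanFail (It Ut : Set (TestLabel Act)) (i : LTS.{u, w} Act) (B : BExp (TestLabel Act))
    (q : i.Q) : Prop :=
  ∃ q', Relation.ReflTransGen (ExprStep It Ut i) (B, q) (.fail, q')

variable {It Ut : Set (TestLabel Act)} {i : LTS.{u, w} Act}

theorem exprStep_of_testExecStep {B : BExp (TestLabel Act)} {x : Option (TestLabel Act)}
    {P P' : (B.toTestLTS It Ut).Q × i.Q} (h : TestExecStep (B.toTestLTS It Ut) i P x P') :
    ExprStep It Ut i (P.1.1.2, P.2) (P'.1.1.2, P'.2) := by
  have key : ∀ {p p' : (B.toTestLTS It Ut).Q} {y : TestLabel Act},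
      (B.toTestLTS It Ut).T p (some y) p' → BExp.Step It p.1.2 y p'.1.2 := by
    rintro p p' y ⟨_, C, h, hs, hp⟩
    cases h
    rw [hp, BExp.occ_snd]
    exact hs
  cases h with
  | tau h => exact .tau h
  | sut h₁ h₂ h₃ => exact .sut h₁ h₂ h₃
  | test h₁ h₂ h₃ => exact .test (key h₁) h₂ h₃
  | sync h₁ h₂ h₃ h₄ => exact .sync (key h₁) h₂ h₃ h₄
  | theta h₁ h₂ => exact .theta (key h₁) h₂

theorem exists_testExecStep_of_exprStep {B : BExp (TestLabel Act)} {p : (B.toTestLTS It Ut).Q}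
    {q q' : i.Q} {C' : BExp (TestLabel Act)} (h : ExprStep It Ut i (p.1.2, q) (C', q')) :
    ∃ p' : (B.toTestLTS It Ut).Q, p'.1.2 = C' ∧
      ∃ x, TestExecStep (B.toTestLTS It Ut) i (p, q) x (p', q') := by
  have key : ∀ {y : TestLabel Act} {C' : BExp (TestLabel Act)}, BExp.Step It p.1.2 y C' →
      ∃ p' : (B.toTestLTS It Ut).Q, p'.1.2 = C' ∧ (B.toTestLTS It Ut).T p (some y) p' :=
    fun {y C'} hs => ⟨⟨BExp.occ (y :: p.1.1) C', .step p.2 hs⟩, BExp.occ_snd _ _,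
      y, C', rfl, hs, rfl⟩
  cases h with
  | tau h => exact ⟨p, rfl, _, .tau h⟩
  | sut h₁ h₂ h₃ => exact ⟨p, rfl, _, .sut h₁ h₂ h₃⟩
  | test h₁ h₂ h₃ =>
    obtain ⟨p', hp', hT⟩ := key h₁
    exact ⟨p', hp', _, .test hT h₂ h₃⟩
  | sync h₁ h₂ h₃ h₄ =>
    obtain ⟨p', hp', hT⟩ := key h₁
    exact ⟨p', hp', _, .sync hT h₂ h₃ h₄⟩
  | theta h₁ h₂ =>
    obtain ⟨p', hp', hT⟩ := key h₁
    exact ⟨p', hp', _, .theta hT h₂⟩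

theorem passes_toTestLTS_iff {B : BExp (TestLabel Act)} :
    Passes i (B.toTestLTS It Ut) ↔ ¬ CanFail It Ut i B i.q₀ := by
  -- Every trace that reaches `fail` is itself a test run.
  have hpass : Passes i (B.toTestLTS It Ut) ↔ ∀ q, ¬ ∃ σ, (testExec (B.toTestLTS It Ut) i).Weak
      (testExec (B.toTestLTS It Ut) i).q₀ σ ((B.toTestLTS It Ut).failState, q) :=
    ⟨fun h q ⟨σ, hσ⟩ => h σ ⟨q, .inr hσ⟩ q hσ, fun h σ _ q hσ => h q ⟨σ, hσ⟩⟩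
  rw [hpass, CanFail, not_exists]
  refine forall_congr' fun q => not_congr ?_
  refine LTS.exists_weak_iff.trans ⟨?_, ?_⟩
  · intro h
    have := Relation.ReflTransGen.lift
      (fun P : (B.toTestLTS It Ut).Q × i.Q => ((P.1.1.2, P.2) : BExp (TestLabel Act) × i.Q))
      (fun P P' ⟨_, h⟩ => exprStep_of_testExecStep h) _ _ h
    simpa [testExec, BExp.toTestLTS, Function.onFun] using this
  · intro h
    have key : ∀ P, Relation.ReflTransGen (ExprStep It Ut i) (B, i.q₀) P →
        ∃ p' : (B.toTestLTS It Ut).Q, p'.1.2 = P.1 ∧ Relation.ReflTransGen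
          (fun a b => ∃ x, (testExec (B.toTestLTS It Ut) i).T a x b)
          (testExec (B.toTestLTS It Ut) i).q₀ (p', P.2) := by
      intro P hP
      induction hP with
      | refl => exact ⟨(B.toTestLTS It Ut).q₀, BExp.occ_snd _ _, .refl⟩
      | @tail P P' _ h ih =>
        obtain ⟨p, hp, hr⟩ := ih
        obtain ⟨C, q⟩ := P
        obtain rfl : p.1.2 = C := hp
        obtain ⟨p', hp', hx⟩ := exists_testExecStep_of_exprStep h
        exact ⟨p', hp', hr.tail hx⟩
    obtain ⟨p, hp, hr⟩ := key _ h
    obtain rfl : p = (B.toTestLTS It Ut).failState :=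
      Subtype.ext (p.2.eq_of_snd_eq .fail (.inr hp) hp)
    exact hr

theorem CanFail.of_exprStep {B B' : BExp (TestLabel Act)} {q q' : i.Q} (h : CanFail It Ut i B' q')
    (hs : ExprStep It Ut i (B, q) (B', q')) : CanFail It Ut i B q :=
  ⟨h.choose, .head hs h.choose_spec⟩

theorem CanFail.of_silent {B : BExp (TestLabel Act)} {q q' : i.Q} (h : CanFail It Ut i B q')
    (hs : i.Silent q q') : CanFail It Ut i B q := by
  induction hs using Relation.ReflTransGen.head_induction_on with
  | refl => exact h
  | head hs _ ih => exact ih.of_exprStep (.tau hs)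

theorem CanFail.of_obsWeak {B B' : BExp (TestLabel Act)} {q q' : i.Q} {x : ObsLabel Act}
    (h : CanFail It Ut i B' q') (hw : i.ObsWeak q [x] q')
    (hs : ∀ q₁ q₂, i.ObsStep q₁ x q₂ → ExprStep It Ut i (B, q₁) (B', q₂)) :
    CanFail It Ut i B q := by
  obtain ⟨q₁, q₂, h₁, h₂, h₃⟩ := hw
  exact ((h.of_silent h₃).of_exprStep (hs q₁ q₂ h₂)).of_silent h₁

end Execution

/-! ### Soundness and exhaustiveness -/

section Completeness

variable {Act : Type u} {e : LTS.{u, v} Act} {i : LTS.{u, w} Act}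

/-- Under a conformance simulation, test execution never leaves the pairs consisting of `pass` and
any state, or of an outcome on `Xe` and a state of a related set `Xs`. -/
theorem not_canFail_of_isEcoSim (hi : i.IsInputEnabled) {R : Set (Set i.Q × Set e.Q)}
    (hR : i.IsEcoSim e R) {Xs : Set i.Q} {Xe : Set e.Q} (hX : (Xs, Xe) ∈ R)
    (hcl : i.SilentClosed Xs) {B : BExp (TestLabel Act)} (hB : GenEcoTest e i.I i.U Xe B)
    {q : i.Q} (hq : q ∈ Xs) :
    ¬ CanFail (testInputs e i.U) (testOutputs e i.I i.U) i B q := by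
  have hIU := hi.1.disjoint
  have inv : ∀ P, Relation.ReflTransGen (ExprStep (testInputs e i.U) (testOutputs e i.I i.U) i)
      (B, q) P → P.1 = .pass ∨ ∃ Xs Xe, (Xs, Xe) ∈ R ∧ i.SilentClosed Xs ∧
        GenEcoTest e i.I i.U Xe P.1 ∧ P.2 ∈ Xs := by
    intro P hP
    induction hP with
    | refl => exact .inr ⟨Xs, Xe, hX, hcl, hB, hq⟩
    | tail _ hstep ih =>
      rcases ih with ih | ⟨Xs, Xe, hX, hcl, hC, hq⟩
      · left
        cases hstep <;> subst ih
        · rfl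
        · rfl
        all_goals exact (BExp.step_pass_iff.1 ‹_›).2
      · cases hstep with
        | tau h => exact .inr ⟨Xs, Xe, hX, hcl, hC, hcl _ hq _ h⟩
        | @sut C q q' a h ha hat =>
          rw [act_mem_labels_iff, not_or] at hat
          have haU : a ∈ i.U := ha.resolve_left hat.2
          have hout : .act a ∈ i.out Xs := LTS.act_mem_out_iff.2 ⟨haU, q, hq, q', h⟩
          exact .inr ⟨_, Xe, hR.internal_sys Xs Xe hX a (.inl hout) hat.1,
            i.silentClosed_after _ _, hC, LTS.mem_after_of_obsStep hq h⟩
        | @test C C' q a hs _ ha =>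
          rcases genEcoTest_iff.1 hC with rfl | ⟨x, Y, D, F, hO, hD, hF, rfl⟩
          · exact .inl (BExp.step_pass_iff.1 hs).2
          · rcases step_choice_inputResponse_iff.1 hs with ⟨rfl, rfl⟩ | ⟨b, hb, h, -⟩ | ⟨k, h, -⟩
            · cases hO with
              | input _ _ h => exact (ha (.inl h)).elim
              | environment _ h _ =>
                exact .inr ⟨Xs, _, hR.internal_env Xs Xe hX a h ha, hcl, hD, hq⟩
              | system _ h => exact (ha (.inl h)).elim
            · cases h
              exact (ha (.inr hb.1.1)).elim
            · cases h
              exact (ha (.inr k.2.1)).elim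
        | @sync C C' q q' a hs h ha _ =>
          rcases genEcoTest_iff.1 hC with rfl | ⟨x, Y, D, F, hO, hD, hF, rfl⟩
          · exact .inl (BExp.step_pass_iff.1 hs).2
          · have hq' : q' ∈ i.after Xs [.act a] := LTS.mem_after_of_obsStep hq h
            have hout : a ∈ i.U → .act a ∈ i.out Xs := fun haU =>
              LTS.act_mem_out_iff.2 ⟨haU, q, hq, q', h⟩
            have hcl' := i.silentClosed_after Xs [.act a]
            rcases step_choice_inputResponse_iff.1 hs with ⟨rfl, rfl⟩ | ⟨b, hb, h, -⟩ | ⟨k, h, rfl⟩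
            · cases hO with
              | input _ h hI =>
                rcases h with h | h
                · exact .inr ⟨_, _, (hR.sync_out_env Xs Xe hX a h hI).2, hcl', hD, hq'⟩
                · exact .inr ⟨_, _, hR.sync_in Xs Xe hX a (hi.inp_eq Xs ▸ hI) h, hcl', hD, hq'⟩
              | environment _ _ h => exact (h ha).elim
              | system _ hI hL =>
                exact .inr ⟨_, _, hR.internal_sys Xs Xe hX a (.inr (hi.inp_eq Xs ▸ hI)) hL,
                  hcl', hD, hq'⟩
            · cases h
              exact (hb.2 (hR.sync_out_sys Xs Xe hX a (hout hb.1.1) hb.1.2).1).elim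
            · cases h
              exact .inr ⟨_, _, (hR.sync_out_sys Xs Xe hX k.1 (hout k.2.1) k.2.2.1).2,
                hcl', hF k, hq'⟩
        | @theta C C' q q' hs h =>
          rcases genEcoTest_iff.1 hC with rfl | ⟨x, Y, D, F, hO, hD, hF, rfl⟩
          · exact .inl (BExp.step_pass_iff.1 hs).2
          · rcases step_choice_inputResponse_iff.1 hs with ⟨rfl, rfl⟩ | ⟨b, hb, h, -⟩ | ⟨k, h, -⟩
            · cases hO with
              | observe hδ =>
                have hδ' : .delta ∈ i.out Xs := ⟨.inl rfl, q, hq, q', h⟩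
                exact .inr ⟨_, _, hR.quiescence Xs Xe hX hδ' hδ, i.silentClosed_after _ _, hD,
                  LTS.mem_after_of_obsStep hq h⟩
            · cases h
            · cases h
  rintro ⟨q', hr⟩
  rcases inv _ hr with h | ⟨_, _, -, -, h, -⟩
  · cases h
  · rcases genEcoTest_iff.1 h with h | ⟨_, _, _, _, -, -, -, h⟩
    · cases h
    · cases h

theorem exists_opening (he : e.IsLTS) {Ii Ui : Set Act} (hU : Disjoint Ui e.U) {X : Set e.Q}
    (hX : e.SilentClosed X) (hne : X.Nonempty) : ∃ x Y, Opening e Ii Ui X x Y := by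
  obtain ⟨a | _, h⟩ := he.out_nonempty hX hne
  · by_cases ha : a ∈ Ii
    · exact ⟨_, _, .input a (.inl h) ha⟩
    · refine ⟨_, _, .environment a (.inl h) ?_⟩
      rintro (h' | h')
      · exact ha h'
      · exact Set.disjoint_left.1 hU h' (LTS.act_mem_out_iff.1 h).1
  · exact ⟨_, _, .observe h⟩

/-- The pairs `(Xs, Xe)` such that no outcome of the test generation on `Xe` can fail from a state
of `Xs`. Nonemptiness and closure of `Xe` guarantee outcomes other than `pass`. -/
def testedPairs (i : LTS.{u, w} Act) (e : LTS.{u, v} Act) : Set (Set i.Q × Set e.Q) :=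
  {P | P.2.Nonempty ∧ e.SilentClosed P.2 ∧ ∀ B, GenEcoTest e i.I i.U P.2 B → ∀ q ∈ P.1,
    ¬ CanFail (testInputs e i.U) (testOutputs e i.I i.U) i B q}

/-- An opening action of the tests on `Xe`, answered by a move from `Xs` to `Xs'` in the test
execution, leads from a tested pair to a tested pair. -/
theorem testedPairs_of_opening {Xs Xs' : Set i.Q} {Xe Y : Set e.Q} {x : TestLabel Act}
    (h : (Xs, Xe) ∈ testedPairs i e) (hO : Opening e i.I i.U Xe x Y) (hne : Y.Nonempty)
    (hcl : e.SilentClosed Y)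
    (hstep : ∀ q' ∈ Xs', ∃ q ∈ Xs, ∀ C D, BExp.Step (testInputs e i.U) C x D →
      CanFail (testInputs e i.U) (testOutputs e i.I i.U) i D q' →
      CanFail (testInputs e i.U) (testOutputs e i.I i.U) i C q) :
    (Xs', Y) ∈ testedPairs i e := by
  refine ⟨hne, hcl, fun B hB q' hq' hf => ?_⟩
  obtain ⟨q, hq, hback⟩ := hstep q' hq'
  exact h.2.2 _ (genEcoTest_iff.2 (.inr ⟨x, Y, B, fun _ => .pass, hO, hB, fun _ => .passed _, rfl⟩))
    q hq (hback _ _ (step_choice_inputResponse_iff.2 (.inl ⟨rfl, rfl⟩)) hf)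

/-- The case of `testedPairs_of_opening` in which both sides take part in a visible action. -/
theorem testedPairs_of_sync_opening {Xs : Set i.Q} {Xe Y : Set e.Q} {a : Act}
    (h : (Xs, Xe) ∈ testedPairs i e) (ha : a ∈ i.I) (hO : Opening e i.I i.U Xe (.act a) Y)
    (hne : Y.Nonempty) (hcl : e.SilentClosed Y) :
    (i.after Xs [.act a], Y) ∈ testedPairs i e := by
  refine testedPairs_of_opening h hO hne hcl ?_
  rintro q' ⟨q, hq, hw⟩
  exact ⟨q, hq, fun C D hs hf => hf.of_obsWeak hw fun q₁ q₂ hT =>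
    .sync hs hT (.inl ha) (act_mem_labels_iff.2 (.inr ha))⟩

theorem isEcoSim_testedPairs (he : e.IsLTS) (hi : i.IsInputEnabled) (hc : i.Composable e)
    (hbase : (i.init, e.init) ∈ testedPairs i e) : i.IsEcoSim e (testedPairs i e) where
  base := hbase
  sync_out_env := by
    intro Xs Xe h a hout ha
    exact ⟨hi.inp_eq Xs ▸ ha, testedPairs_of_sync_opening h ha (.input a (.inl hout) ha)
      (LTS.after_nonempty_of_mem_out hout) (e.silentClosed_after _ _)⟩
  sync_out_sys := by
    intro Xs Xe h a hout ha
    obtain ⟨x, Y, hO⟩ := exists_opening (Ii := i.I) he hc h.2.1 h.1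
    have haU := (LTS.act_mem_out_iff.1 hout).1
    have hat : .act a ∈ testInputs e i.U ∪ testOutputs e i.I i.U :=
      .inl (act_mem_testInputs_iff.2 ⟨haU, ha⟩)
    have hin : a ∈ e.inp Xe := by
      by_contra hin
      obtain ⟨-, q, hq, q', hT⟩ := LTS.act_mem_out_iff.1 hout
      refine h.2.2 _ (genEcoTest_iff.2 (.inr ⟨x, Y, .pass, fun _ => .pass, hO, .passed _,
        fun _ => .passed _, rfl⟩)) q hq ⟨q', .single (.sync ?_ hT (.inr haU) hat)⟩
      exact step_choice_inputResponse_iff.2 (.inr (.inl ⟨a, ⟨⟨haU, ha⟩, hin⟩, rfl, rfl⟩))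
    refine ⟨hin, LTS.after_nonempty_of_mem_inp h.1 hin, e.silentClosed_after _ _, ?_⟩
    rintro B hB q' ⟨q, hq, hw⟩ hf
    classical
    -- The given outcome continues after the response to `a`; all other branches stop with `pass`.
    refine h.2.2 _ (genEcoTest_iff.2 (.inr ⟨x, Y, .pass, fun k => if k.1 = a then B else .pass, hO,
      .passed _, fun k => ?_, rfl⟩)) q hq (hf.of_obsWeak hw fun q₁ q₂ hT =>
        .sync ?_ hT (.inr haU) hat)
    · by_cases hk : k.1 = a
      · simpa [hk] using hB
      · simpa [hk] using GenEcoTest.passed _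
    · exact step_choice_inputResponse_iff.2 (.inr (.inr ⟨⟨a, haU, hin⟩, rfl, by simp⟩))
  internal_env := by
    intro Xs Xe h a ha haL
    have hO : Opening e i.I i.U Xe (.act a) _ := .environment a ha haL
    refine testedPairs_of_opening h hO ?_ (e.silentClosed_after _ _) fun q hq =>
      ⟨q, hq, fun C D hs hf => hf.of_exprStep (.test hs hO.mem_labels haL)⟩
    rcases ha with ha | ha
    · exact LTS.after_nonempty_of_mem_out ha
    · exact LTS.after_nonempty_of_mem_inp h.1 ha
  internal_sys := by
    intro Xs Xe h a ha haL
    rcases ha with ha | ha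
    · -- An output of the system unknown to the environment passes unnoticed by the test.
      have haU := (LTS.act_mem_out_iff.1 ha).1
      refine ⟨h.1, h.2.1, ?_⟩
      rintro B hB q' ⟨q, hq, hw⟩ hf
      refine h.2.2 B hB q hq (hf.of_obsWeak hw fun q₁ q₂ hT => .sut hT (.inr haU) ?_)
      rw [act_mem_labels_iff, not_or]
      exact ⟨haL, fun haI => Set.disjoint_left.1 hi.1.disjoint haI haU⟩
    · exact testedPairs_of_sync_opening h ha.1 (.system a ha.1 haL) h.1 h.2.1
  sync_in := by
    intro Xs Xe h a ha ha'
    exact testedPairs_of_sync_opening h ha.1 (.input a (.inr ha') ha.1)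
      (LTS.after_nonempty_of_mem_inp h.1 ha') (e.silentClosed_after _ _)
  quiescence := by
    intro Xs Xe h _ hδ
    refine testedPairs_of_opening h (.observe hδ) (LTS.after_nonempty_of_mem_out hδ)
      (e.silentClosed_after _ _) ?_
    rintro q' ⟨q, hq, hw⟩
    exact ⟨q, hq, fun C D hs hf => hf.of_obsWeak hw fun q₁ q₂ hT => .theta hs hT⟩

end Completeness

end EcoTesting

theorem mainTheorem5 {Act : Type u} (e : EcoTesting.LTS.{u, v} Act) (he : e.IsLTS)
    (Ii Ui : Set Act) (hIi : Ii.Countable) (hUi : Ui.Countable) (hIU : Disjoint Ii Ui) :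
    (∀ t ∈ EcoTesting.ecoTestSuite e Ii Ui, t.IsTestCase) ∧
      ∀ i : EcoTesting.LTS.{u, w} Act, i.IsInputEnabled → i.I = Ii → i.U = Ui →
        i.Composable e →
        (i.Eco e ↔ EcoTesting.PassesSuite i (EcoTesting.ecoTestSuite e Ii Ui)) := by
  constructor
  · rintro t ⟨B, hB, rfl⟩
    exact EcoTesting.toTestLTS_isTestCase he hIi hUi hIU (.inr ⟨_, hB⟩)
  · rintro i hi rfl rfl hc
    constructor
    · rintro ⟨R, hR⟩ t ⟨B, hB, rfl⟩
      exact EcoTesting.passes_toTestLTS_iff.2 (EcoTesting.not_canFail_of_isEcoSim hi hR hR.base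
        (i.silentClosed_after _ _) hB ⟨i.q₀, rfl, .refl⟩)
    · intro h
      refine ⟨_, EcoTesting.isEcoSim_testedPairs he hi hc
        ⟨⟨e.q₀, e.q₀, rfl, .refl⟩, e.silentClosed_after _ _, ?_⟩⟩
      rintro B hB q ⟨_, rfl, hq⟩ hf
      exact EcoTesting.passes_toTestLTS_iff.1 (h _ ⟨B, hB, rfl⟩) (hf.of_silent hq)
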